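/- **Theorem (WFA is $k$-competitive on multiray spaces).** *Multiray spaces.* A multiray space is a tree of depth one all of whose edges ("rays") have infinite length, with all points of the edges included. That is, for an index set $I$ it consists of a center $c$ and the points $(i,x)$ with $i\in I$ and $x>0$, with the path metric $d(c,(i,x))=x$, $d((i,x),(i,y))=|x-y|$, and $d((i,x),(j,y))=x+y$ for $i\neq j$. *The $k$-server problem.* Let $(M,d)$ be a metric space and $k\ge 1$. A configuration is a multiset of $k$ points of $M$, and $d(X,Y)$ denotes the cost of a minimum-cost perfect matching between the configurations $X$ and $Y$. An instance consists of an initial configuration $C_0$ and requests $r_1,\dots,r_T\in M$. A feasible solution is a sequence $C_1,\dots,C_T$ of configurations with $r_t\in C_t$ for all $t$. Its cost is $\sum_{t=1}^T d(C_{t-1},C_t)$, and $\mathrm{OPT}$ is the minimal cost of a feasible solution. *The work function algorithm (WFA).* The work function at time $t$ is $$w_t(C)=\min_{\substack{C_1,\dots,C_t\\ r_\tau\in C_\tau}}\ \sum_{\tau=1}^{t} d(C_{\tau-1},C_\tau)+d(C_t,C).$$ At time $t$, WFA moves to a configuration $C_t\ni r_t$ that minimizes $d(C_{t-1},C_t)+w_t(C_t)$,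 with ties broken arbitrarily. *Competitiveness.* WFA is $\rho$-competitive on $M$ if a minimizing $C_t$ always exists and, for every bounded set $B\subseteq M$, there is a constant $c_B$ such that for every initial configuration $C_0$ with all points in $B$, every finite request sequence in $M$ and every way of breaking ties, the cost of WFA is at most $\rho\cdot\mathrm{OPT}+c_B$. In particular the additive constant does not depend on the requests. If $M$ is bounded, then the constant can be chosen independently of $C_0$ as well. *Statement.* For every $k\ge 1$, WFA for $k$ servers is $k$-competitive on every multiray space. In particular, it is $k$-competitive on the real line, and on every weighted star, i.e. every metric space $(S,d)$ for which there are weights $a_x\ge 0$ $(x\in S)$ with $d(x,y)=a_x+a_y$ for all $x\neq y$. -/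

import Mathlib

universe u v

/-- The multiray space with rays indexed by `ι`: a center from which, for every `i : ι`, a ray of
infinite length originates. `Multiray.ray i x hx` is the point of the `i`-th ray that lies at
distance `x > 0` from the center. -/
inductive Multiray (ι : Type u) : Type u
  | center : Multiray ι
  | ray (i : ι) (x : ℝ) (hx : 0 < x) : Multiray ι

namespace Multiray

open Classical in
/-- The shortest-path distance of the multiray space. -/
noncomputable def pathDist {ι : Type u} : Multiray ι → Multiray ι → ℝ
  | center, center => 0
  | center, ray _ y _ => y
  | ray _ x _, center => x
  | ray i x _, ray j y _ => if i = j then |x - y| else x + y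

noncomputable instance instMetricSpace (ι : Type u) : MetricSpace (Multiray ι) where
  dist := pathDist
  dist_self p := by
    cases p <;> simp [pathDist]
  dist_comm p q := by
    rcases p with _ | ⟨i, x, hx⟩ <;> rcases q with _ | ⟨j, y, hy⟩ <;>
      simp only [pathDist]
    by_cases h : i = j
    · simp [h, abs_sub_comm]
    · simp [h, Ne.symm h, add_comm]
  dist_triangle p q r := by
    rcases p with _ | ⟨i, x, hx⟩ <;> rcases q with _ | ⟨j, y, hy⟩ <;>
      rcases r with _ | ⟨l, z, hz⟩ <;> simp only [pathDist] <;> grind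
  eq_of_dist_eq_zero {p q} h := by
    change pathDist p q = 0 at h
    rcases p with _ | ⟨i, x, hx⟩ <;> rcases q with _ | ⟨j, y, hy⟩ <;>
      simp only [pathDist] at h
    · rfl
    · exact absurd h hy.ne'
    · exact absurd h hx.ne'
    · split_ifs at h with hij
      · have hxy : x = y := sub_eq_zero.mp (abs_eq_zero.mp h)
        subst hij
        subst hxy
        rfl
      · linarith

end Multiray

namespace KServer

variable {M : Type u} [MetricSpace M] {k : ℕ}

/-- `d(X, Y)`: the cost of a minimum matching between two configurations, i.e. between two
multisets of `k` points. A perfect matching is a multiset of pairs whose first components form `X`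
and whose second components form `Y`. There are finitely many of them and at least one, so that
the infimum is a minimum. -/
noncomputable def matchDist (X Y : Sym M k) : ℝ :=
  sInf {s : ℝ | ∃ P : Multiset (M × M),
    P.map Prod.fst = (X : Multiset M) ∧ P.map Prod.snd = (Y : Multiset M) ∧
      s = (P.map fun p => dist p.1 p.2).sum}

/-- `C 0, …, C T` is a feasible solution for the initial configuration `C₀` and the `T` requests
`r 0, …, r (T - 1)`: the configuration `C (t + 1)` serves the `(t + 1)`-st request `r t`. -/
def IsFeasible (C₀ : Sym M k) (r : ℕ → M) (T : ℕ) (C : ℕ → Sym M k) : Prop :=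
  C 0 = C₀ ∧ ∀ t < T, r t ∈ C (t + 1)

/-- The cost of the first `T` moves of a sequence of configurations. -/
noncomputable def cost (C : ℕ → Sym M k) (T : ℕ) : ℝ :=
  ∑ t ∈ Finset.range T, matchDist (C t) (C (t + 1))

/-- The optimal offline cost for the first `T` requests. -/
noncomputable def opt (C₀ : Sym M k) (r : ℕ → M) (T : ℕ) : ℝ :=
  sInf {s : ℝ | ∃ C : ℕ → Sym M k, IsFeasible C₀ r T C ∧ s = cost C T}

/-- The work function `w_t`: the optimal cost of serving the first `t` requests and ending in the
configuration `X`. -/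
noncomputable def workFunction (C₀ : Sym M k) (r : ℕ → M) (t : ℕ) (X : Sym M k) : ℝ :=
  sInf {s : ℝ | ∃ C : ℕ → Sym M k, IsFeasible C₀ r t C ∧ s = cost C t + matchDist (C t) X}

/-- `C 0, …, C T` is a run of the work function algorithm on the first `T` requests: among the
configurations that contain the current request, `C (t + 1)` minimizes
`d(C t, ·) + w_{t + 1}(·)`. Ties are broken arbitrarily. -/
def IsWFARun (C₀ : Sym M k) (r : ℕ → M) (T : ℕ) (C : ℕ → Sym M k) : Prop :=
  IsFeasible C₀ r T C ∧
    ∀ t < T, ∀ X : Sym M k, r t ∈ X →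
      matchDist (C t) (C (t + 1)) + workFunction C₀ r (t + 1) (C (t + 1)) ≤
        matchDist (C t) X + workFunction C₀ r (t + 1) X

/-- The work function algorithm for `k` servers is `ρ`-competitive on `M`: it is well defined (its
minima are attained), and however it breaks ties, its cost is at most `ρ` times the optimal
offline cost plus an additive constant that depends neither on the requests nor on their number.
The constant is uniform over all initial configurations inside a given bounded set `B`; if `M` is
bounded, `B = M` yields a constant that depends on `M` and `k` only. -/
def WFACompetitive (M : Type u) [MetricSpace M] (k : ℕ) (ρ : ℝ) : Prop :=
  (∀ (C₀ : Sym M k) (r : ℕ → M) (T : ℕ), ∃ C : ℕ → Sym M k, IsWFARun C₀ r T C) ∧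
    ∀ B : Set M, Bornology.IsBounded B →
      ∃ c : ℝ, ∀ C₀ : Sym M k, (∀ p ∈ C₀, p ∈ B) →
        ∀ (r : ℕ → M) (T : ℕ) (C : ℕ → Sym M k), IsWFARun C₀ r T C →
          cost C T ≤ ρ * opt C₀ r T + c

end KServer

/-!
The proof bounds the extended cost of the requests, i.e. the largest possible increase of the work
function at each request, by a potential. The points are located on rays, and the work function is
extended from configurations to multisets of *ends* of rays, the distance from an end `l` being
the function `b l` that is `-h` on the ray `l` and `h` elsewhere, where `h` is the distance from the
center (`work`, `endWork`). The function `w` so obtained on multisets of `k` ends is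
quasi-convex (`quasiConvex_endWork`), and the potential is the minimum over all ends `x₁, …, x_k` of
`∑ i, w(x̄ᵢ ⋯ x̄ᵢ xᵢ₊₁ ⋯ x_k)` with `i = 0, …, k`, where the `i` entries `x̄ᵢ` are ends different from
`xᵢ`, chosen so as to minimize `w`.

The central fact is that in this minimum the entries `x_k, x_{k-1}, …` can be chosen greedily as the
elements of an arbitrary minimizer of `w`, in an arbitrary order (`avoid_add_potential_le`). It
follows by induction from an interchange of two consecutive entries, which quasi-convexity
permits (`avoid_add_avoid_le`).

Consider a request at height `s` on the ray `j`, and a multiset `n` of ends that minimizes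
`w n + 2 * s * n.count j` before the request. Let `w'` be the work function after the request. Then
the extended cost is at most `w' n - w n`, and `n` also minimizes `w' n + 2 * s * n.count j`
(`work_succ_sub_le`, `endWork_succ_sub_le`).
If some minimizer of `w'` contains `j` more often than `n` does, let the sequence of the `xᵢ` end
with the copies of `j` from that minimizer; otherwise `n` itself minimizes `w'`, and the `xᵢ` can be
taken to be its elements. In both cases `w' n` is one of the terms of an optimal sequence, while the
other terms do not decrease. So the potential increases by at least `w' n - w n`
(`potential_add_le`).

The potential is bounded below at the start in terms of the heights of the initial configuration,
and it never exceeds `k + 1` times the work function at any configuration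
(`neg_sum_le_endWork_zero`, `potential_le_mul`). Since the cost of the algorithm plus the optimal cost
is at most the sum of the extended costs, the cost is at most `k` times the optimal cost plus a
constant.
-/

namespace KServer

/-! ### Quasi-convex functions of multisets -/

/-- A function `w` of multisets of size `k` is quasi-convex if any two such multisets `A`, `B`
admit a perfect matching `P` such that exchanging an arbitrary set `Q'` of matched pairs does not
increase `w A + w B`. The matching is a multiset of pairs, and a set of pairs to be exchanged is
given by a decomposition `Q + Q' = P`. -/
def QuasiConvex {α : Type*} (k : ℕ) (w : Multiset α → ℝ) : Prop :=
  ∀ A B : Multiset α, A.card = k → B.card = k →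
    ∃ P : Multiset (α × α), P.map Prod.fst = A ∧ P.map Prod.snd = B ∧
      ∀ Q Q' : Multiset (α × α), Q + Q' = P →
        w (Q.map Prod.fst + Q'.map Prod.snd) + w (Q.map Prod.snd + Q'.map Prod.fst) ≤ w A + w B

/-- A matching of `r ::ₘ A` and `r ::ₘ B` can be turned into one that matches the two copies of `r`
with each other, such that every exchange along the new matching is also an exchange along
the old one. The new matching is `P'`, with the pair `(r, r)` left out. -/
theorem exists_matching_erase {α : Type*} {r : α} {A B : Multiset α} {P : Multiset (α × α)}
    (hA : P.map Prod.fst = r ::ₘ A) (hB : P.map Prod.snd = r ::ₘ B) :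
    ∃ P' : Multiset (α × α), P'.map Prod.fst = A ∧ P'.map Prod.snd = B ∧
      ∀ Q Q' : Multiset (α × α), Q + Q' = P' → ∃ R R' : Multiset (α × α), R + R' = P ∧
        R.map Prod.fst + R'.map Prod.snd = r ::ₘ (Q.map Prod.fst + Q'.map Prod.snd) ∧
        R.map Prod.snd + R'.map Prod.fst = r ::ₘ (Q.map Prod.snd + Q'.map Prod.fst) := by
  have hr : r ∈ P.map Prod.fst := by simp [hA]
  obtain ⟨⟨r₁, b⟩, hmem, h1⟩ := Multiset.mem_map.1 hr
  simp only at h1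
  subst h1
  obtain ⟨P₁, rfl⟩ := Multiset.exists_cons_of_mem hmem
  simp only [Multiset.map_cons, Multiset.cons_inj_right] at hA hB
  by_cases hb : b = r₁
  · subst hb
    rw [Multiset.cons_inj_right] at hB
    refine ⟨P₁, hA, hB, fun Q Q' h => ⟨(b, b) ::ₘ Q, Q', ?_, ?_, ?_⟩⟩ <;> simp [← h]
  · have hr' : r₁ ∈ P₁.map Prod.snd := by
      have : r₁ ∈ b ::ₘ P₁.map Prod.snd := by rw [hB]; simp
      simpa [Ne.symm hb] using this
    obtain ⟨⟨a, r₂⟩, hmem', h2⟩ := Multiset.mem_map.1 hr'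
    simp only at h2
    subst h2
    obtain ⟨P₀, rfl⟩ := Multiset.exists_cons_of_mem hmem'
    simp only [Multiset.map_cons] at hA hB
    rw [Multiset.cons_swap, Multiset.cons_inj_right] at hB
    refine ⟨(a, b) ::ₘ P₀, by simpa using hA, by simpa using hB, fun Q Q' h => ?_⟩
    have hab : (a, b) ∈ Q + Q' := by simp [h]
    rcases Multiset.mem_add.1 hab with hQ | hQ
    · obtain ⟨Q, rfl⟩ := Multiset.exists_cons_of_mem hQ
      rw [Multiset.cons_add, Multiset.cons_inj_right] at h
      refine ⟨(a, r₂) ::ₘ (r₂, b) ::ₘ Q, Q', ?_, ?_, ?_⟩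
      · rw [← h]; simp [Multiset.cons_swap]
      · simp [Multiset.cons_swap]
      · simp
    · obtain ⟨Q', rfl⟩ := Multiset.exists_cons_of_mem hQ
      rw [Multiset.add_cons, Multiset.cons_inj_right] at h
      refine ⟨Q, (a, r₂) ::ₘ (r₂, b) ::ₘ Q', ?_, ?_, ?_⟩
      · rw [← h]; simp [Multiset.cons_swap]
      · simp
      · simp [Multiset.cons_swap]

theorem QuasiConvex.contract {α : Type*} {k : ℕ} {w : Multiset α → ℝ}
    (hw : QuasiConvex (k + 1) w) (a : α) : QuasiConvex k fun n => w (a ::ₘ n) := by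
  intro A B hA hB
  obtain ⟨P, h1, h2, h3⟩ := hw (a ::ₘ A) (a ::ₘ B) (by simp [hA]) (by simp [hB])
  obtain ⟨P', h1', h2', h3'⟩ := exists_matching_erase h1 h2
  refine ⟨P', h1', h2', fun Q Q' h => ?_⟩
  obtain ⟨R, R', hR, e1, e2⟩ := h3' Q Q' h
  simpa only [e1, e2] using h3 R R' hR

/-- The exchange property: any element of `B` can be exchanged for some element of `A`. -/
theorem QuasiConvex.exchange {α : Type*} {k : ℕ} {w : Multiset α → ℝ}
    (hw : QuasiConvex (k + 1) w) {A B : Multiset α} {b : α} (hA : A.card = k + 1)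
    (hB : (b ::ₘ B).card = k + 1) :
    ∃ p A', A = p ::ₘ A' ∧ w (b ::ₘ A') + w (p ::ₘ B) ≤ w A + w (b ::ₘ B) := by
  obtain ⟨P, h1, h2, h3⟩ := hw A (b ::ₘ B) hA hB
  have hb : b ∈ P.map Prod.snd := by simp [h2]
  obtain ⟨⟨p, b'⟩, hmem, hb'⟩ := Multiset.mem_map.1 hb
  simp only at hb'
  subst hb'
  obtain ⟨P₁, rfl⟩ := Multiset.exists_cons_of_mem hmem
  simp only [Multiset.map_cons, Multiset.cons_inj_right] at h1 h2
  refine ⟨p, P₁.map Prod.fst, h1.symm, ?_⟩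
  have := h3 {(p, b')} P₁ (by simp)
  rw [add_comm]
  simpa [h2] using this

/-! ### The potential -/

section Potential

variable {L : Type*} [Fintype L]

/-- `n` minimizes `w` among the multisets of size `k`. -/
def IsMinimizer (k : ℕ) (w : Multiset L → ℝ) (n : Multiset L) : Prop :=
  n.card = k ∧ ∀ m : Multiset L, m.card = k → w n ≤ w m

/-- The minimum of `w` over the multisets of size `k` that do not contain `b`. -/
noncomputable def avoid (b : L) (k : ℕ) (w : Multiset L → ℝ) : ℝ :=
  ⨅ n : {n : Sym L k // b ∉ n}, w (n.1 : Multiset L)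

/-- The potential of a function of multisets of size `k`: the minimum over all `x₁, …, x_k` of
`∑ i, w(x̄ᵢ ⋯ x̄ᵢ xᵢ₊₁ ⋯ x_k)`, where `i` runs from `0` to `k` and the `i` entries `x̄ᵢ` stand for an
arbitrary choice of elements different from `xᵢ`, made so as to minimize `w`. It is defined by
recursion, the minimum over `x_k` being the outermost one. -/
noncomputable def potential : ℕ → (Multiset L → ℝ) → ℝ
  | 0, w => w 0
  | k + 1, w => ⨅ b : L, (avoid b (k + 1) w + potential k fun n => w (b ::ₘ n))

theorem exists_isMinimizer [Nonempty L] (k : ℕ) (w : Multiset L → ℝ) :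
    ∃ n, IsMinimizer k w n := by
  classical
  obtain ⟨o⟩ := ‹Nonempty L›
  have : Nonempty (Sym L k) := ⟨Sym.replicate k o⟩
  obtain ⟨n, hn⟩ := Finite.exists_min fun n : Sym L k => w (n : Multiset L)
  exact ⟨n, n.2, fun m hm => hn ⟨m, hm⟩⟩

theorem avoid_le {b : L} {k : ℕ} (w : Multiset L → ℝ) {n : Multiset L} (hn : n.card = k)
    (hb : b ∉ n) : avoid b k w ≤ w n := by
  classical
  exact ciInf_le (Set.finite_range fun n : {n : Sym L k // b ∉ n} => w (n.1 : Multiset L)).bddBelow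
    ⟨⟨n, hn⟩, hb⟩

theorem exists_avoid_eq [Nontrivial L] (b : L) (k : ℕ) (w : Multiset L → ℝ) :
    ∃ n : Multiset L, n.card = k ∧ b ∉ n ∧ avoid b k w = w n := by
  classical
  obtain ⟨o, ho⟩ := exists_ne b
  have : Nonempty {n : Sym L k // b ∉ n} :=
    ⟨⟨Sym.replicate k o, fun h => ho (Sym.mem_replicate.1 h).2.symm⟩⟩
  obtain ⟨n, hn⟩ :=
    exists_eq_ciInf_of_finite (f := fun n : {n : Sym L k // b ∉ n} => w (n.1 : Multiset L))
  exact ⟨n.1, n.1.2, n.2, hn.symm⟩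

theorem potential_succ_le (b : L) (k : ℕ) (w : Multiset L → ℝ) :
    potential (k + 1) w ≤ avoid b (k + 1) w + potential k fun n => w (b ::ₘ n) :=
  ciInf_le (Set.finite_range _).bddBelow b

theorem avoid_mono [Nontrivial L] {b : L} {k : ℕ} {w w' : Multiset L → ℝ}
    (h : ∀ n, n.card = k → w n ≤ w' n) : avoid b k w ≤ avoid b k w' := by
  obtain ⟨n, hn, hb, e⟩ := exists_avoid_eq b k w'
  rw [e]
  exact (avoid_le w hn hb).trans (h n hn)

theorem potential_mono [Nontrivial L] {k : ℕ} {w w' : Multiset L → ℝ}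
    (h : ∀ n, n.card = k → w n ≤ w' n) : potential k w ≤ potential k w' := by
  induction k generalizing w w' with
  | zero => exact h 0 rfl
  | succ k ih =>
    refine le_ciInf fun b => (potential_succ_le b k w).trans (add_le_add (avoid_mono h) ?_)
    exact ih fun n hn => h _ (by simp [hn])

theorem le_potential [Nontrivial L] {k : ℕ} {w : Multiset L → ℝ} {c : ℝ}
    (h : ∀ n, n.card = k → c ≤ w n) : (k + 1) * c ≤ potential k w := by
  induction k generalizing w with
  | zero => simpa [potential] using h 0 rfl
  | succ k ih =>
    refine le_ciInf fun b => ?_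
    obtain ⟨n, hn, hb, e⟩ := exists_avoid_eq b (k + 1) w
    have h1 := h n hn
    have h2 := ih (w := fun n => w (b ::ₘ n)) fun n hn => h _ (by simp [hn])
    push_cast
    linarith

/-- Two consecutive entries of the sequence in the definition of the potential can be interchanged
so that an element of a minimizer comes first. -/
theorem avoid_add_avoid_le [Nontrivial L] {k : ℕ} {w : Multiset L → ℝ}
    (hw : QuasiConvex (k + 1) w) {n : Multiset L} (hn : IsMinimizer (k + 1) w n) {a b : L}
    (hb : b ∈ n) (hab : a ≠ b) :
    avoid b (k + 1) w + avoid a k (fun n => w (b ::ₘ n)) ≤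
      avoid a (k + 1) w + avoid b k (fun n => w (a ::ₘ n)) := by
  obtain ⟨P, hP, haP, eP⟩ := exists_avoid_eq a (k + 1) w
  obtain ⟨Q, hQ, hbQ, eQ⟩ := exists_avoid_eq b k fun n => w (a ::ₘ n)
  rw [eP, eQ, add_comm]
  refine add_le_add ?_ (avoid_le w (by simp [hQ]) (by simp [hbQ, hab.symm]))
  -- If `b ∈ P`, then `P` and `a ::ₘ Q` just trade their roles. Otherwise `b` is first brought
  -- into `P`, by an exchange with the minimizer.
  by_cases hbP : b ∈ P
  · obtain ⟨P, rfl⟩ := Multiset.exists_cons_of_mem hbP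
    exact avoid_le (fun n => w (b ::ₘ n)) (by simpa using hP) fun h => haP (by simp [h])
  · obtain ⟨n, rfl⟩ := Multiset.exists_cons_of_mem hb
    obtain ⟨p, P', rfl, h⟩ := hw.exchange hP hn.1
    have h1 := hn.2 (p ::ₘ n) (by simpa using hn.1)
    have h2 : avoid a k (fun n => w (b ::ₘ n)) ≤ w (b ::ₘ P') :=
      avoid_le (fun n => w (b ::ₘ n)) (by simpa using hP) fun h => haP (by simp [h])
    linarith

/-- In the definition of the potential, the minimum over the last entry `x_k` is attained at any
element of any minimizer. -/
theorem avoid_add_potential_le [Nontrivial L] {k : ℕ} {w : Multiset L → ℝ}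
    (hw : QuasiConvex (k + 1) w) {n : Multiset L} (hn : IsMinimizer (k + 1) w n) {b : L}
    (hb : b ∈ n) (a : L) :
    avoid b (k + 1) w + potential k (fun n => w (b ::ₘ n)) ≤
      avoid a (k + 1) w + potential k (fun n => w (a ::ₘ n)) := by
  induction k generalizing w n a b with
  | zero =>
    rcases eq_or_ne a b with rfl | hab
    · exact le_rfl
    have hn1 : n = {b} := by
      obtain ⟨c, rfl⟩ := Multiset.card_eq_one.1 hn.1
      rw [Multiset.mem_singleton.1 hb]
    subst hn1
    obtain ⟨P, hP, haP, eP⟩ := exists_avoid_eq a 1 w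
    have h1 := hn.2 P hP
    have h2 : avoid b 1 w ≤ w {a} := avoid_le w (by simp) (by simpa using hab.symm)
    simp only [potential, Multiset.cons_zero, zero_add] at *
    linarith
  | succ k ih =>
    -- The claim holds if `b` also belongs to a minimizer of the contraction by `a`.
    have key : ∀ {a b : L}, a ≠ b → b ∈ n →
        (∃ ν, IsMinimizer (k + 1) (fun n => w (a ::ₘ n)) ν ∧ b ∈ ν) →
        avoid b (k + 2) w + potential (k + 1) (fun n => w (b ::ₘ n)) ≤
          avoid a (k + 2) w + potential (k + 1) (fun n => w (a ::ₘ n)) := by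
      rintro a b hab hb ⟨ν, hν, hbν⟩
      have h1 : avoid b (k + 1) (fun n => w (a ::ₘ n)) +
          potential k (fun n => w (a ::ₘ b ::ₘ n)) ≤
          potential (k + 1) (fun n => w (a ::ₘ n)) :=
        le_ciInf fun c => ih (hw.contract a) hν hbν c
      have h2 := potential_succ_le a k fun n => w (b ::ₘ n)
      have h3 := avoid_add_avoid_le hw hn hb hab
      simp only [Multiset.cons_swap b a] at h2
      linarith
    rcases eq_or_ne a b with rfl | hab
    · exact le_rfl
    by_cases ha : a ∈ n
    · obtain ⟨ν, rfl⟩ := Multiset.exists_cons_of_mem ha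
      refine key hab hb ⟨ν, ⟨by simpa using hn.1, fun m hm => hn.2 _ (by simp [hm])⟩, ?_⟩
      simpa [hab.symm] using hb
    · obtain ⟨ν, hν⟩ := exists_isMinimizer (k + 1) fun n => w (a ::ₘ n)
      obtain ⟨q, n', rfl, hq⟩ := hw.exchange hn.1 (B := ν) (b := a) (by simp [hν.1])
      have hn' : n'.card = k + 1 := by simpa using hn.1
      have hmin : IsMinimizer (k + 1) (fun n => w (a ::ₘ n)) n' := by
        refine ⟨hn', fun m hm => le_trans ?_ (hν.2 m hm)⟩
        have := hn.2 (q ::ₘ ν) (by simp [hν.1])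
        linarith
      by_cases hbn : b ∈ n'
      · exact key hab hb ⟨n', hmin, hbn⟩
      · -- Otherwise the comparison passes through another element `e` of the minimizer.
        obtain ⟨e, he⟩ := Multiset.card_pos_iff_exists_mem.1 (by omega : 0 < n'.card)
        have heb : e ≠ b := fun h => hbn (h ▸ he)
        have hen : e ∈ q ::ₘ n' := by simp [he]
        refine (key heb hb ?_).trans (key (fun h => ha (h ▸ hen)) hen ⟨n', hmin, he⟩)
        obtain ⟨μ, hμ⟩ := Multiset.exists_cons_of_mem hen
        rw [hμ] at hn hb
        refine ⟨μ, ⟨by simpa using hn.1, fun m hm => hn.2 _ (by simp [hm])⟩, ?_⟩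
        simpa [heb.symm] using hb

theorem potential_succ_eq [Nontrivial L] {k : ℕ} {w : Multiset L → ℝ}
    (hw : QuasiConvex (k + 1) w) {n : Multiset L} {b : L}
    (hn : IsMinimizer (k + 1) w (b ::ₘ n)) :
    potential (k + 1) w = avoid b (k + 1) w + potential k (fun n => w (b ::ₘ n)) :=
  (potential_succ_le b k w).antisymm
    (le_ciInf fun a => avoid_add_potential_le hw hn (by simp) a)

/-- If `n` minimizes `w'`, then `w' n` is one of the terms of the potential, namely the one with
`i = 0` for an enumeration `x₁, …, x_k` of `n`. -/
theorem potential_add_le_of_isMinimizer [Nontrivial L] {k : ℕ} {w w' : Multiset L → ℝ}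
    (hw' : QuasiConvex k w') (hle : ∀ n, n.card = k → w n ≤ w' n) {n : Multiset L}
    (hn : IsMinimizer k w' n) : potential k w + (w' n - w n) ≤ potential k w' := by
  induction k generalizing w w' n with
  | zero =>
    obtain rfl := Multiset.card_eq_zero.1 hn.1
    simp [potential]
  | succ k ih =>
    obtain ⟨b, hb⟩ := Multiset.card_pos_iff_exists_mem.1 (by rw [hn.1]; omega : 0 < n.card)
    obtain ⟨n, rfl⟩ := Multiset.exists_cons_of_mem hb
    rw [potential_succ_eq hw' hn]
    have h1 := potential_succ_le b k w
    have h2 := avoid_mono (b := b) hle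
    have h3 := ih (hw'.contract b) (w := fun n => w (b ::ₘ n)) (n := n)
      (fun m hm => hle _ (by simp [hm]))
      ⟨by simpa using hn.1, fun m hm => hn.2 _ (by simp [hm])⟩
    linarith

/-- If `n` minimizes `w'` among the multisets with the same multiplicity `m` of `j`, and if some
minimizer of `w'` has a larger multiplicity of `j`, then `w' n` is one of the terms of
the potential, namely the one with `i = k - m` for a sequence that ends with `m + 1` copies
of `j`. -/
theorem potential_add_le_of_count_lt [Nontrivial L] [DecidableEq L] {k : ℕ}
    {w w' : Multiset L → ℝ} (hw' : QuasiConvex k w') (hle : ∀ n, n.card = k → w n ≤ w' n)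
    {j : L} {n ν : Multiset L} (hn : n.card = k)
    (hmin : ∀ m : Multiset L, m.card = k → m.count j = n.count j → w' n ≤ w' m)
    (hν : IsMinimizer k w' ν) (hlt : n.count j < ν.count j) :
    potential k w + (w' n - w n) ≤ potential k w' := by
  induction k generalizing w w' n ν with
  | zero =>
    obtain rfl := Multiset.card_eq_zero.1 hν.1
    simp at hlt
  | succ k ih =>
    obtain ⟨ν, rfl⟩ := Multiset.exists_cons_of_mem (Multiset.count_pos.1 (by omega : 0 < ν.count j))
    rw [potential_succ_eq hw' hν]
    have h1 := potential_succ_le j k w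
    by_cases hj : j ∈ n
    · obtain ⟨n, rfl⟩ := Multiset.exists_cons_of_mem hj
      have h2 := avoid_mono (b := j) hle
      have h3 := ih (hw'.contract j) (w := fun n => w (j ::ₘ n)) (n := n) (ν := ν)
        (fun m hm => hle _ (by simp [hm])) (by simpa using hn)
        (fun m hm hc => hmin _ (by simp [hm]) (by simp [hc]))
        ⟨by simpa using hν.1, fun m hm => hν.2 _ (by simp [hm])⟩ (by simpa using hlt)
      linarith
    · obtain ⟨m, hm, hjm, e⟩ := exists_avoid_eq j (k + 1) w'
      have h2 := hmin m hm (by rw [Multiset.count_eq_zero.2 hjm, Multiset.count_eq_zero.2 hj])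
      have h3 := avoid_le w hn hj
      have h4 : potential k (fun n => w (j ::ₘ n)) ≤ potential k (fun n => w' (j ::ₘ n)) :=
        potential_mono fun m hm => hle _ (by simp [hm])
      linarith

/-- The increase of the potential from `w` to `w'`. For a request at height `s` on the ray `j`, the
total distance of the ends in `n` from the request is a constant minus `2 * s * n.count j`, so that
the multiset `n` of the lemma minimizes the work function minus this total distance
if `c = 2 * s`. -/
theorem potential_add_le [Nontrivial L] [DecidableEq L] {k : ℕ}
    {w w' : Multiset L → ℝ} (hw' : QuasiConvex k w') (hle : ∀ n, n.card = k → w n ≤ w' n)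
    {j : L} {n : Multiset L} {c : ℝ} (hc : 0 ≤ c)
    (hn : IsMinimizer k (fun m => w' m + c * m.count j) n) :
    potential k w + (w' n - w n) ≤ potential k w' := by
  obtain ⟨ν, hν⟩ := exists_isMinimizer k w'
  rcases lt_or_ge (n.count j) (ν.count j) with h | h
  · refine potential_add_le_of_count_lt hw' hle hn.1 (fun m hm hmj => ?_) hν h
    simpa [hmj] using hn.2 m hm
  · refine potential_add_le_of_isMinimizer hw' hle ⟨hn.1, fun m hm => ?_⟩
    have h1 := hn.2 ν hν.1
    have h2 := hν.2 m hm
    have h3 : c * (ν.count j : ℝ) ≤ c * (n.count j : ℝ) := by gcongr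
    simp only at h1
    linarith

end Potential

/-! ### Matchings as multisets of pairs -/

theorem exists_coupling {α β γ : Type*} {f : α → γ} {g : β → γ} {s : Multiset α}
    {t : Multiset β} (h : s.map f = t.map g) :
    ∃ T : Multiset (α × β), T.map Prod.fst = s ∧ T.map Prod.snd = t ∧
      ∀ p ∈ T, f p.1 = g p.2 := by
  induction s using Multiset.induction_on generalizing t with
  | empty =>
    refine ⟨0, by simp, ?_, by simp⟩
    rw [Multiset.map_zero] at h
    rw [Multiset.map_eq_zero.1 h.symm, Multiset.map_zero]
  | cons a s ih =>
    have ha : f a ∈ t.map g := by simp [← h]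
    obtain ⟨b, hb, hab⟩ := Multiset.mem_map.1 ha
    obtain ⟨t, rfl⟩ := Multiset.exists_cons_of_mem hb
    rw [Multiset.map_cons, Multiset.map_cons, hab, Multiset.cons_inj_right] at h
    obtain ⟨T, h1, h2, h3⟩ := ih h
    refine ⟨(a, b) ::ₘ T, by simp [h1], by simp [h2], fun p hp => ?_⟩
    rcases Multiset.mem_cons.1 hp with rfl | hp
    · exact hab.symm
    · exact h3 p hp

theorem exists_add_of_map_eq_add {α β : Type*} {f : α → β} {T : Multiset α} {Q Q' : Multiset β}
    (h : Q + Q' = T.map f) : ∃ R R', R + R' = T ∧ R.map f = Q ∧ R'.map f = Q' := by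
  induction Q using Multiset.induction_on generalizing T with
  | empty => exact ⟨0, T, by simp, by simp, by simpa using h.symm⟩
  | cons q Q ih =>
    have hq : q ∈ T.map f := by simp [← h]
    obtain ⟨a, ha, rfl⟩ := Multiset.mem_map.1 hq
    obtain ⟨T, rfl⟩ := Multiset.exists_cons_of_mem ha
    rw [Multiset.map_cons, Multiset.cons_add, Multiset.cons_inj_right] at h
    obtain ⟨R, R', rfl, rfl, rfl⟩ := ih h
    exact ⟨a ::ₘ R, R', by simp, by simp, rfl⟩

theorem exists_matching {α β : Type*} {X : Multiset α} {Y : Multiset β} (h : X.card = Y.card) :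
    ∃ P : Multiset (α × β), P.map Prod.fst = X ∧ P.map Prod.snd = Y := by
  obtain ⟨P, h1, h2, -⟩ := exists_coupling (f := fun _ : α => ()) (g := fun _ : β => ()) (s := X)
    (t := Y) (by simp [h])
  exact ⟨P, h1, h2⟩

theorem finite_setOf_matching {α β : Type*} (X : Multiset α) (Y : Multiset β) :
    {P : Multiset (α × β) | P.map Prod.fst = X ∧ P.map Prod.snd = Y}.Finite := by
  classical
  refine ((X.card • (X ×ˢ Y)).powerset.finite_toSet).subset fun P ⟨h1, h2⟩ => ?_
  rw [Set.mem_ofPred_eq, Multiset.mem_powerset, Multiset.le_iff_count]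
  intro p
  by_cases hp : p ∈ P
  · have hmem : p ∈ X ×ˢ Y := by
      rw [Multiset.mem_product, ← h1, ← h2]
      exact ⟨Multiset.mem_map_of_mem _ hp, Multiset.mem_map_of_mem _ hp⟩
    have hc : P.card = X.card := by rw [← h1, Multiset.card_map]
    rw [Multiset.count_nsmul]
    calc P.count p ≤ X.card * 1 := by rw [mul_one, ← hc]; exact Multiset.count_le_card _ _
      _ ≤ X.card * (X ×ˢ Y).count p :=
        Nat.mul_le_mul_left _ (Multiset.one_le_count_iff_mem.2 hmem)
  · rw [Multiset.count_eq_zero.2 hp]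
    exact Nat.zero_le _

theorem finite_setOf_matching_cost {α β : Type*} (e : α × β → ℝ) (X : Multiset α)
    (Y : Multiset β) : {s : ℝ | ∃ P : Multiset (α × β), P.map Prod.fst = X ∧ P.map Prod.snd = Y ∧
      s = (P.map e).sum}.Finite := by
  refine ((finite_setOf_matching X Y).image fun P => (P.map e).sum).subset ?_
  rintro s ⟨P, h1, h2, rfl⟩
  exact ⟨P, ⟨h1, h2⟩, rfl⟩

/-! ### Work functions on generalized points -/

section Work

variable {S : Type*} [MetricSpace S] {L : Type*}

/-- A generalized point is a point of `S` or an end `l : L`. The distance of an end from a point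
is given by the function `b l`, which stands for the distance from a point far out on a ray,
up to an additive constant that depends on `l` only. -/
noncomputable def gdist (b : L → S → ℝ) : S ⊕ L → S → ℝ :=
  Sum.elim dist b

@[simp] theorem gdist_inl (b : L → S → ℝ) (x y : S) : gdist b (Sum.inl x) y = dist x y := rfl

@[simp] theorem gdist_inr (b : L → S → ℝ) (l : L) (y : S) : gdist b (Sum.inr l) y = b l y := rfl

/-- The work function, extended to multisets of generalized points. It is given by the recursion
that lets a single server move for each request, at the time `t + 1` along the request `r t`. -/
noncomputable def work (b : L → S → ℝ) (C₀ : Multiset S) (r : ℕ → S) :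
    ℕ → Multiset (S ⊕ L) → ℝ
  | 0, Y => sInf {s : ℝ | ∃ P : Multiset (S × (S ⊕ L)), P.map Prod.fst = C₀ ∧
      P.map Prod.snd = Y ∧ s = (P.map fun p => gdist b p.2 p.1).sum}
  | t + 1, Y => sInf {s : ℝ | ∃ y Y', Y = y ::ₘ Y' ∧
      s = work b C₀ r t (Sum.inl (r t) ::ₘ Y') + gdist b y (r t)}

variable {b : L → S → ℝ} {C₀ : Multiset S} {r : ℕ → S}

theorem work_zero_le {P : Multiset (S × (S ⊕ L))} (h : P.map Prod.fst = C₀) :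
    work b C₀ r 0 (P.map Prod.snd) ≤ (P.map fun p => gdist b p.2 p.1).sum :=
  csInf_le (finite_setOf_matching_cost _ _ _).bddBelow ⟨P, h, rfl, rfl⟩

theorem exists_work_zero_eq {Y : Multiset (S ⊕ L)} (h : Y.card = C₀.card) :
    ∃ P : Multiset (S × (S ⊕ L)), P.map Prod.fst = C₀ ∧ P.map Prod.snd = Y ∧
      work b C₀ r 0 Y = (P.map fun p => gdist b p.2 p.1).sum := by
  obtain ⟨P, h1, h2⟩ := exists_matching h.symm
  have hmem := Set.Nonempty.csInf_mem (by exact ⟨_, P, h1, h2, rfl⟩)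
    (finite_setOf_matching_cost (fun p : S × (S ⊕ L) => gdist b p.2 p.1) C₀ Y)
  exact hmem

theorem finite_work_succ (t : ℕ) (Y : Multiset (S ⊕ L)) :
    {s : ℝ | ∃ y Y', Y = y ::ₘ Y' ∧
      s = work b C₀ r t (Sum.inl (r t) ::ₘ Y') + gdist b y (r t)}.Finite := by
  classical
  refine (Y.finite_toSet.image fun y =>
    work b C₀ r t (Sum.inl (r t) ::ₘ Y.erase y) + gdist b y (r t)).subset ?_
  rintro s ⟨y, Y', rfl, rfl⟩
  exact ⟨y, by simp, by simp⟩

theorem work_succ_le (t : ℕ) (y : S ⊕ L) (Y : Multiset (S ⊕ L)) :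
    work b C₀ r (t + 1) (y ::ₘ Y) ≤
      work b C₀ r t (Sum.inl (r t) ::ₘ Y) + gdist b y (r t) :=
  csInf_le (finite_work_succ t _).bddBelow ⟨y, Y, rfl, rfl⟩

theorem exists_work_succ_eq (t : ℕ) {Y : Multiset (S ⊕ L)} (h : 0 < Y.card) :
    ∃ y Y', Y = y ::ₘ Y' ∧ work b C₀ r (t + 1) Y =
      work b C₀ r t (Sum.inl (r t) ::ₘ Y') + gdist b y (r t) := by
  obtain ⟨y, hy⟩ := Multiset.card_pos_iff_exists_mem.1 h
  obtain ⟨Y', rfl⟩ := Multiset.exists_cons_of_mem hy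
  have hmem := Set.Nonempty.csInf_mem (by exact ⟨_, y, Y', rfl, rfl⟩)
    (finite_work_succ (b := b) (C₀ := C₀) (r := r) t (y ::ₘ Y'))
  exact hmem

theorem gdist_le (hb : ∀ l x y, b l x ≤ b l y + dist x y) (p : S ⊕ L) (x y : S) :
    gdist b p x ≤ gdist b p y + dist x y := by
  rcases p with z | l
  · simpa [dist_comm x y] using dist_triangle z y x
  · exact hb l x y

theorem work_cons_le (hb : ∀ l x y, b l x ≤ b l y + dist x y) (t : ℕ) (y : S ⊕ L) (x : S)
    {Y : Multiset (S ⊕ L)} (hY : Y.card + 1 = C₀.card) :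
    work b C₀ r t (y ::ₘ Y) ≤ work b C₀ r t (Sum.inl x ::ₘ Y) + gdist b y x := by
  induction t generalizing Y x y with
  | zero =>
    obtain ⟨P, h1, h2, e⟩ := exists_work_zero_eq (b := b) (C₀ := C₀) (r := r)
      (Y := Sum.inl x ::ₘ Y) (by simpa using hY)
    have hx : Sum.inl x ∈ P.map Prod.snd := by simp [h2]
    obtain ⟨⟨c, x'⟩, hmem, hx'⟩ := Multiset.mem_map.1 hx
    simp only at hx'
    subst hx'
    obtain ⟨P, rfl⟩ := Multiset.exists_cons_of_mem hmem
    simp only [Multiset.map_cons, Multiset.cons_inj_right] at h1 h2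
    have h3 := work_zero_le (b := b) (r := r) (P := (c, y) ::ₘ P) (C₀ := C₀) (by simp [h1])
    have h4 := gdist_le hb y c x
    rw [e]
    simp only [Multiset.map_cons, Multiset.sum_cons, h2, gdist_inl, dist_comm x c] at h3 ⊢
    linarith
  | succ t ih =>
    obtain ⟨m, Y', hm, e⟩ := exists_work_succ_eq (b := b) (C₀ := C₀) (r := r) t
      (Y := Sum.inl x ::ₘ Y) (by simp)
    rw [e]
    rcases Multiset.cons_eq_cons.1 hm with ⟨rfl, rfl⟩ | ⟨-, Z, rfl, rfl⟩
    · have h1 := work_succ_le (b := b) (C₀ := C₀) (r := r) t y Y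
      have h2 := gdist_le hb y (r t) x
      rw [gdist_inl, dist_comm]
      linarith
    · have h1 := work_succ_le (b := b) (C₀ := C₀) (r := r) t m (y ::ₘ Z)
      have h2 := ih y x (Y := Sum.inl (r t) ::ₘ Z) (by simpa using hY)
      rw [Multiset.cons_swap m y, Multiset.cons_swap (Sum.inl (r t)) y] at h1
      rw [Multiset.cons_swap (Sum.inl (r t)) (Sum.inl x)]
      linarith

/-- The work function is Lipschitz with respect to matchings of points with generalized points. -/
theorem work_le_add_sum (hb : ∀ l x y, b l x ≤ b l y + dist x y) (t : ℕ)
    (P : Multiset (S × (S ⊕ L))) (Z : Multiset (S ⊕ L)) (h : P.card + Z.card = C₀.card) :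
    work b C₀ r t (P.map Prod.snd + Z) ≤
      work b C₀ r t (P.map (fun p => Sum.inl p.1) + Z) +
        (P.map fun p => gdist b p.2 p.1).sum := by
  induction P using Multiset.induction_on generalizing Z with
  | empty => simp
  | cons p P ih =>
    have h1 := ih (p.2 ::ₘ Z) (by simp at h ⊢; omega)
    have h2 := work_cons_le (r := r) hb t p.2 p.1 (Y := P.map (fun p => Sum.inl p.1) + Z)
      (C₀ := C₀) (by simp at h ⊢; omega)
    simp only [Multiset.map_cons, Multiset.sum_cons, Multiset.cons_add, Multiset.add_cons] at *
    linarith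

theorem work_le_work_succ (hb : ∀ l x y, b l x ≤ b l y + dist x y) (t : ℕ)
    {Y : Multiset (S ⊕ L)} (hY : Y.card = C₀.card) (hpos : 0 < Y.card) :
    work b C₀ r t Y ≤ work b C₀ r (t + 1) Y := by
  obtain ⟨y, Y', rfl, e⟩ := exists_work_succ_eq (b := b) (C₀ := C₀) (r := r) t hpos
  rw [e]
  exact work_cons_le hb t y (r t) (by simpa using hY)

/-- Quasi-convexity of work functions. A request preserves it: it prescribes one element of both
multisets, and these two elements may be taken to be matched with each other. -/
theorem quasiConvex_work (t : ℕ) : QuasiConvex C₀.card (work b C₀ r t) := by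
  induction t with
  | zero =>
    intro A B hA hB
    obtain ⟨P, h1, rfl, e⟩ := exists_work_zero_eq (b := b) (r := r) hA
    obtain ⟨P', h1', rfl, e'⟩ := exists_work_zero_eq (b := b) (r := r) hB
    obtain ⟨T, rfl, rfl, hT⟩ := exists_coupling (h1.trans h1'.symm)
    refine ⟨T.map fun x => (x.1.2, x.2.2), by simp, by simp, fun Q Q' h => ?_⟩
    obtain ⟨R, R', rfl, rfl, rfl⟩ := exists_add_of_map_eq_add h
    have hR : R.map (fun x => x.1.1) = R.map fun x => x.2.1 :=
      Multiset.map_congr rfl fun p hp => hT p (by simp [hp])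
    have hR' : R'.map (fun x => x.1.1) = R'.map fun x => x.2.1 :=
      Multiset.map_congr rfl fun p hp => hT p (by simp [hp])
    have h2 := work_zero_le (b := b) (r := r) (C₀ := C₀) (P := R.map Prod.fst + R'.map Prod.snd)
      (by simpa [hR'] using h1)
    have h3 := work_zero_le (b := b) (r := r) (C₀ := C₀) (P := R.map Prod.snd + R'.map Prod.fst)
      (by simpa [← hR] using h1)
    rw [e, e']
    simp only [Multiset.map_add, Multiset.map_map, Multiset.sum_add, Function.comp_def] at h2 h3 ⊢
    linarith
  | succ t ih =>
    intro A B hA hB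
    rcases Nat.eq_zero_or_pos C₀.card with h0 | hpos
    · obtain rfl := Multiset.card_eq_zero.1 (hA.trans h0)
      obtain rfl := Multiset.card_eq_zero.1 (hB.trans h0)
      refine ⟨0, rfl, rfl, fun Q Q' h => ?_⟩
      obtain ⟨rfl, rfl⟩ := add_eq_zero.1 h
      simp
    obtain ⟨x, A, rfl, eA⟩ := exists_work_succ_eq (b := b) (C₀ := C₀) (r := r) t (hA ▸ hpos)
    obtain ⟨y, B, rfl, eB⟩ := exists_work_succ_eq (b := b) (C₀ := C₀) (r := r) t (hB ▸ hpos)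
    obtain ⟨P, h1, h2, h3⟩ := ih (Sum.inl (r t) ::ₘ A) (Sum.inl (r t) ::ₘ B) (by simpa using hA)
      (by simpa using hB)
    obtain ⟨P', rfl, rfl, h3'⟩ := exists_matching_erase h1 h2
    refine ⟨(x, y) ::ₘ P', by simp, by simp, fun Q Q' h => ?_⟩
    have hmem : (x, y) ∈ Q + Q' := by simp [h]
    rw [eA, eB]
    rcases Multiset.mem_add.1 hmem with hQ | hQ
    · obtain ⟨Q, rfl⟩ := Multiset.exists_cons_of_mem hQ
      rw [Multiset.cons_add, Multiset.cons_inj_right] at h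
      obtain ⟨R, R', hR, e1, e2⟩ := h3' Q Q' h
      have h4 := h3 R R' hR
      rw [e1, e2] at h4
      have h5 := work_succ_le (b := b) (C₀ := C₀) (r := r) t x
        (Q.map Prod.fst + Q'.map Prod.snd)
      have h6 := work_succ_le (b := b) (C₀ := C₀) (r := r) t y
        (Q.map Prod.snd + Q'.map Prod.fst)
      simp only [Multiset.map_cons, Multiset.cons_add]
      linarith
    · obtain ⟨Q', rfl⟩ := Multiset.exists_cons_of_mem hQ
      rw [Multiset.add_cons, Multiset.cons_inj_right] at h
      obtain ⟨R, R', hR, e1, e2⟩ := h3' Q Q' h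
      have h4 := h3 R R' hR
      rw [e1, e2] at h4
      have h5 := work_succ_le (b := b) (C₀ := C₀) (r := r) t y
        (Q.map Prod.fst + Q'.map Prod.snd)
      have h6 := work_succ_le (b := b) (C₀ := C₀) (r := r) t x
        (Q.map Prod.snd + Q'.map Prod.fst)
      simp only [Multiset.map_cons, Multiset.add_cons]
      linarith

/-- The work function on multisets of ends. -/
noncomputable def endWork (b : L → S → ℝ) (C₀ : Multiset S) (r : ℕ → S) (t : ℕ)
    (n : Multiset L) : ℝ :=
  work b C₀ r t (n.map Sum.inr)

theorem quasiConvex_endWork (t : ℕ) : QuasiConvex C₀.card (endWork b C₀ r t) := by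
  intro A B hA hB
  obtain ⟨P, h1, h2, h3⟩ := quasiConvex_work (b := b) (C₀ := C₀) (r := r) t (A.map Sum.inr)
    (B.map Sum.inr) (by simpa using hA) (by simpa using hB)
  obtain ⟨T, rfl, rfl, hT⟩ := exists_coupling h1.symm
  obtain ⟨U, rfl, rfl, hU⟩ := exists_coupling (f := fun p : L × ((S ⊕ L) × (S ⊕ L)) => p.2.2)
    (g := (Sum.inr : L → S ⊕ L)) (s := T) (t := B) (by rw [← h2]; simp)
  refine ⟨U.map fun u => (u.1.1, u.2), by simp, by simp, fun Q Q' h => ?_⟩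
  obtain ⟨R, R', rfl, rfl, rfl⟩ := exists_add_of_map_eq_add h
  have h4 := h3 (R.map fun u => u.1.2) (R'.map fun u => u.1.2) (by simp)
  have key : ∀ u ∈ R + R', u.1.2 = (Sum.inr u.1.1, Sum.inr u.2) := fun u hu =>
    Prod.ext (hT u.1 (Multiset.mem_map_of_mem _ hu)).symm (hU u hu)
  have e1 : R.map (fun u => u.1.2) = R.map fun u => (Sum.inr u.1.1, Sum.inr u.2) :=
    Multiset.map_congr rfl fun u hu => key u (by simp [hu])
  have e2 : R'.map (fun u => u.1.2) = R'.map fun u => (Sum.inr u.1.1, Sum.inr u.2) :=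
    Multiset.map_congr rfl fun u hu => key u (by simp [hu])
  rw [e1, e2] at h4
  simpa only [endWork, Multiset.map_add, Multiset.map_map, Function.comp_def] using h4

/-- Duality, first part: a multiset `n` of ends that minimizes the work function minus the total
distance from the request still does so when the request has been served. -/
theorem endWork_succ_sub_le {t : ℕ} {n : Multiset L} (hpos : 0 < C₀.card)
    (hn : n.card = C₀.card)
    (hmin : ∀ m : Multiset L, m.card = C₀.card →
      endWork b C₀ r t n - (n.map fun l => b l (r t)).sum ≤
        endWork b C₀ r t m - (m.map fun l => b l (r t)).sum)
    {m : Multiset L} (hm : m.card = C₀.card) :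
    endWork b C₀ r (t + 1) n - (n.map fun l => b l (r t)).sum ≤
      endWork b C₀ r (t + 1) m - (m.map fun l => b l (r t)).sum := by
  obtain ⟨y, Y, hY, e⟩ := exists_work_succ_eq (b := b) (C₀ := C₀) (r := r) t
    (Y := m.map Sum.inr) (by rw [Multiset.card_map, hm]; exact hpos)
  have hy : y ∈ m.map Sum.inr := by simp [hY]
  obtain ⟨l, hl, rfl⟩ := Multiset.mem_map.1 hy
  obtain ⟨m, rfl⟩ := Multiset.exists_cons_of_mem hl
  rw [Multiset.map_cons, Multiset.cons_inj_right] at hY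
  subst hY
  obtain ⟨k, hk⟩ : ∃ k, C₀.card = k + 1 := ⟨C₀.card - 1, by omega⟩
  obtain ⟨p, A, hA, h⟩ := (hk ▸ quasiConvex_work (b := b) (C₀ := C₀) (r := r) t).exchange
    (A := n.map Sum.inr) (b := Sum.inl (r t)) (B := m.map Sum.inr)
    (by rw [Multiset.card_map, hn, hk]) (by rw [← hk, ← hm]; simp)
  have hp : p ∈ n.map Sum.inr := by simp [hA]
  obtain ⟨q, hq, rfl⟩ := Multiset.mem_map.1 hp
  obtain ⟨n, rfl⟩ := Multiset.exists_cons_of_mem hq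
  rw [Multiset.map_cons, Multiset.cons_inj_right] at hA
  subst hA
  have h1 := work_succ_le (b := b) (C₀ := C₀) (r := r) t (Sum.inr q) (n.map Sum.inr)
  have h2 := hmin (q ::ₘ m) (by simpa using hm)
  simp only [endWork, Multiset.map_cons, Multiset.sum_cons, gdist_inr] at *
  linarith

/-- Duality, second part: if the multiset `n` of ends minimizes the work function minus the total
distance from the request, then no configuration has a larger increase of its work function
than `n`. -/
theorem work_succ_sub_le (hb : ∀ l x y, b l x ≤ b l y + dist x y) {t : ℕ} {n : Multiset L}
    (hpos : 0 < C₀.card) (hn : n.card = C₀.card)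
    (hmin : ∀ m : Multiset L, m.card = C₀.card →
      endWork b C₀ r t n - (n.map fun l => b l (r t)).sum ≤
        endWork b C₀ r t m - (m.map fun l => b l (r t)).sum)
    {X : Multiset S} (hX : X.card = C₀.card)
    (hfar : ∀ x ∈ X, ∃ l, b l x + dist x (r t) ≤ b l (r t)) :
    work b C₀ r (t + 1) (X.map Sum.inl) - work b C₀ r t (X.map Sum.inl) ≤
      endWork b C₀ r (t + 1) n - endWork b C₀ r t n := by
  obtain ⟨y, Y, hY, e⟩ := exists_work_succ_eq (b := b) (C₀ := C₀) (r := r) t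
    (Y := n.map Sum.inr) (by rw [Multiset.card_map, hn]; exact hpos)
  have hy : y ∈ n.map Sum.inr := by simp [hY]
  obtain ⟨q, hq, rfl⟩ := Multiset.mem_map.1 hy
  obtain ⟨n, rfl⟩ := Multiset.exists_cons_of_mem hq
  rw [Multiset.map_cons, Multiset.cons_inj_right] at hY
  subst hY
  obtain ⟨k, hk⟩ : ∃ k, C₀.card = k + 1 := ⟨C₀.card - 1, by omega⟩
  obtain ⟨p, A, hA, h⟩ := (hk ▸ quasiConvex_work (b := b) (C₀ := C₀) (r := r) t).exchange
    (A := X.map Sum.inl) (b := Sum.inl (r t)) (B := n.map Sum.inr)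
    (by rw [Multiset.card_map, hX, hk]) (by rw [← hk, ← hn]; simp)
  have hp : p ∈ X.map Sum.inl := by simp [hA]
  obtain ⟨x, hx, rfl⟩ := Multiset.mem_map.1 hp
  obtain ⟨X, rfl⟩ := Multiset.exists_cons_of_mem hx
  rw [Multiset.map_cons, Multiset.cons_inj_right] at hA
  subst hA
  obtain ⟨l, hl⟩ := hfar x hx
  have h1 := work_succ_le (b := b) (C₀ := C₀) (r := r) t (Sum.inl x) (X.map Sum.inl)
  have h2 := hmin (l ::ₘ n) (by simpa using hn)
  have h3 := work_cons_le (r := r) hb t (Sum.inr l) x (Y := n.map Sum.inr) (C₀ := C₀)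
    (by simpa using hn)
  simp only [endWork, Multiset.map_cons, Multiset.sum_cons, gdist_inr, gdist_inl] at *
  linarith

end Work

/-! ### The cost of a matching -/

section Matching

variable {S : Type*} [MetricSpace S] {k : ℕ}

theorem matchDist_le {X Y : Sym S k} {P : Multiset (S × S)}
    (h1 : P.map Prod.fst = (X : Multiset S)) (h2 : P.map Prod.snd = (Y : Multiset S)) :
    matchDist X Y ≤ (P.map fun p => dist p.1 p.2).sum :=
  csInf_le (finite_setOf_matching_cost _ _ _).bddBelow ⟨P, h1, h2, rfl⟩

theorem exists_matchDist_eq (X Y : Sym S k) :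
    ∃ P : Multiset (S × S), P.map Prod.fst = (X : Multiset S) ∧
      P.map Prod.snd = (Y : Multiset S) ∧ matchDist X Y = (P.map fun p => dist p.1 p.2).sum := by
  obtain ⟨P, h1, h2⟩ := exists_matching (X.2.trans Y.2.symm)
  have hmem := Set.Nonempty.csInf_mem (by exact ⟨_, P, h1, h2, rfl⟩)
    (finite_setOf_matching_cost (fun p : S × S => dist p.1 p.2) X Y)
  exact hmem

theorem matchDist_nonneg (X Y : Sym S k) : 0 ≤ matchDist X Y := by
  obtain ⟨P, -, -, e⟩ := exists_matchDist_eq X Y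
  rw [e]
  refine Multiset.sum_nonneg fun x hx => ?_
  obtain ⟨p, -, rfl⟩ := Multiset.mem_map.1 hx
  exact dist_nonneg

theorem matchDist_comm_le (X Y : Sym S k) : matchDist X Y ≤ matchDist Y X := by
  obtain ⟨P, h1, h2, e⟩ := exists_matchDist_eq Y X
  refine (matchDist_le (P := P.map Prod.swap) (by simpa) (by simpa)).trans ?_
  simp [e, dist_comm]

theorem matchDist_cons_le {x y : S} {X : Multiset S} (hx : (x ::ₘ X).card = k)
    (hy : (y ::ₘ X).card = k) :
    matchDist (⟨x ::ₘ X, hx⟩ : Sym S k) ⟨y ::ₘ X, hy⟩ ≤ dist x y := by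
  refine (matchDist_le (P := (x, y) ::ₘ X.map fun x => (x, x)) ?_ ?_).trans ?_
  · simp
  · simp
  · simp

theorem cost_nonneg (C : ℕ → Sym S k) (T : ℕ) : 0 ≤ cost C T :=
  Finset.sum_nonneg fun _ _ => matchDist_nonneg _ _

theorem cost_succ (C : ℕ → Sym S k) (T : ℕ) :
    cost C (T + 1) = cost C T + matchDist (C T) (C (T + 1)) :=
  Finset.sum_range_succ _ _

theorem opt_le_cost {C₀ : Sym S k} {r : ℕ → S} {T : ℕ} {C : ℕ → Sym S k}
    (h : IsFeasible C₀ r T C) : opt C₀ r T ≤ cost C T :=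
  csInf_le ⟨0, by rintro _ ⟨C, -, rfl⟩; exact cost_nonneg C T⟩ ⟨C, h, rfl⟩

end Matching

/-! ### Bounds for the potential -/

/-- An upper bound for the potential, where `w` is the work function on ends and `v` its value at a
configuration `X`. The points `y₁, …, y_k` of `X` are listed by increasing distance `h` from the
center, and `xᵢ` is the ray of `yᵢ`. In the term with index `i`, the points `y₁, …, yᵢ` move out on
a ray other than `xᵢ` and pay at most `h yᵢ` each; this is made up for by the `i` terms with smaller
indices, in each of which `yᵢ` moves out on its own ray and gains `h yᵢ`. -/
theorem potential_le_mul {S L : Type*} [Fintype L] [Nontrivial L] {b : L → S → ℝ} {h : S → ℝ}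
    (hbh : ∀ l x, b l x ≤ h x) {k : ℕ} {w : Multiset L → ℝ} {v : ℝ} {X : Multiset S} (hX : X.card = k)
    (hend : ∀ x ∈ X, ∃ l, b l x = -h x)
    (hw : ∀ P : Multiset (S × L), P.map Prod.fst = X →
      w (P.map Prod.snd) ≤ v + (P.map fun p => b p.2 p.1).sum) :
    potential k w ≤ (k + 1) * v := by
  induction k generalizing w v X with
  | zero =>
    obtain rfl := Multiset.card_eq_zero.1 hX
    simpa [potential] using hw 0 rfl
  | succ k ih =>
    obtain ⟨z, hz, hmax⟩ : ∃ z ∈ X, ∀ x ∈ X, h x ≤ h z := by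
      classical
      obtain ⟨x, hx⟩ := Multiset.card_pos_iff_exists_mem.1 (by omega : 0 < X.card)
      simpa using X.toFinset.exists_max_image h ⟨x, by simpa using hx⟩
    obtain ⟨l, hl⟩ := hend z hz
    obtain ⟨o, ho⟩ := exists_ne l
    have h1 : avoid l (k + 1) w ≤ v + (k + 1) * h z := by
      have h2 := hw (X.map fun x => (x, o)) (by simp)
      have h3 : ((X.map fun x => (x, o)).map fun p => b p.2 p.1).sum ≤ (k + 1) * h z := by
        have := Multiset.sum_le_card_nsmul (X.map fun x => b o x) (h z) (by
          intro y hy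
          obtain ⟨x, hx, rfl⟩ := Multiset.mem_map.1 hy
          exact (hbh o x).trans (hmax x hx))
        simpa [Function.comp_def, hX] using this
      have h4 : avoid l (k + 1) w ≤ w ((X.map fun x => (x, o)).map Prod.snd) := by
        refine avoid_le w (by simpa using hX) fun hmem => ?_
        obtain ⟨p, hp, rfl⟩ := Multiset.mem_map.1 hmem
        obtain ⟨x, -, rfl⟩ := Multiset.mem_map.1 hp
        exact ho rfl
      linarith
    obtain ⟨X, rfl⟩ := Multiset.exists_cons_of_mem hz
    have h5 := ih (w := fun n => w (l ::ₘ n)) (v := v - h z) (X := X) (by simpa using hX)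
      (fun x hx => hend x (by simp [hx])) fun P hP => by
        have := hw ((z, l) ::ₘ P) (by simp [hP])
        simp only [Multiset.map_cons, Multiset.sum_cons, hl] at this
        linarith
    have h6 := potential_succ_le l k w
    push_cast
    linarith

/-! ### Work functions and the work function algorithm -/

section Algorithm

variable {S : Type*} [MetricSpace S] {L : Type*} {k : ℕ}

/-- The value of the extended work function at a configuration. -/
noncomputable def workAt (b : L → S → ℝ) (C₀ : Sym S k) (r : ℕ → S) (t : ℕ) (X : Sym S k) : ℝ :=
  work b (C₀ : Multiset S) r t ((X : Multiset S).map Sum.inl)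

variable {b : L → S → ℝ} {C₀ : Sym S k} {r : ℕ → S}

theorem workAt_le_add_matchDist (hb : ∀ l x y, b l x ≤ b l y + dist x y) (t : ℕ)
    (X Y : Sym S k) : workAt b C₀ r t Y ≤ workAt b C₀ r t X + matchDist X Y := by
  obtain ⟨P, h1, h2, e⟩ := exists_matchDist_eq X Y
  have hP : P.card = k := by rw [← Multiset.card_map Prod.fst, h1]; exact X.2
  have h := work_le_add_sum (r := r) (C₀ := (C₀ : Multiset S)) hb t
    (P.map fun p => (p.1, Sum.inl p.2)) 0 (by simp [hP])
  rw [workAt, workAt, e, ← h1, ← h2]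
  simpa [Function.comp_def, dist_comm] using h

theorem workAt_zero_le : workAt b C₀ r 0 C₀ ≤ 0 := by
  have := work_zero_le (b := b) (r := r) (C₀ := (C₀ : Multiset S))
    (P := (C₀ : Multiset S).map fun x => (x, Sum.inl x)) (by simp)
  simpa [workAt, Function.comp_def] using this

theorem workAt_succ_le {t : ℕ} {X : Sym S k} (hX : r t ∈ X) :
    workAt b C₀ r (t + 1) X ≤ workAt b C₀ r t X := by
  obtain ⟨X', hX'⟩ := Multiset.exists_cons_of_mem (show r t ∈ (X : Multiset S) from hX)
  have := work_succ_le (b := b) (C₀ := (C₀ : Multiset S)) (r := r) t (Sum.inl (r t))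
    (X'.map Sum.inl)
  simpa [workAt, hX'] using this

theorem workAt_le_cost (hb : ∀ l x y, b l x ≤ b l y + dist x y) {t : ℕ} {C : ℕ → Sym S k}
    (hC : IsFeasible C₀ r t C) : workAt b C₀ r t (C t) ≤ cost C t := by
  induction t with
  | zero =>
    rw [hC.1]
    simpa [cost] using workAt_zero_le (b := b)
  | succ t ih =>
    have h1 := ih ⟨hC.1, fun s hs => hC.2 s (by omega)⟩
    have h2 := workAt_succ_le (b := b) (C₀ := C₀) (hC.2 t (by omega))
    have h3 := workAt_le_add_matchDist (C₀ := C₀) (r := r) hb t (C t) (C (t + 1))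
    rw [cost_succ]
    linarith

/-- The minimum in the recursion for the work function: the configuration `Y` arises from `X` by
moving one server to the request `r t`. -/
theorem exists_workAt_succ_eq (hk : 1 ≤ k) (t : ℕ) (X : Sym S k) :
    ∃ Y : Sym S k, r t ∈ Y ∧
      workAt b C₀ r t Y + matchDist X Y ≤ workAt b C₀ r (t + 1) X := by
  obtain ⟨y, Y', hY, e⟩ := exists_work_succ_eq (b := b) (C₀ := (C₀ : Multiset S)) (r := r) t
    (Y := (X : Multiset S).map Sum.inl) (by simp; omega)
  have hy : y ∈ (X : Multiset S).map (Sum.inl : S → S ⊕ L) := by simp [hY]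
  obtain ⟨x, hx, rfl⟩ := Multiset.mem_map.1 hy
  obtain ⟨X, hX⟩ := X
  obtain ⟨X', rfl⟩ := Multiset.exists_cons_of_mem (show x ∈ X from hx)
  replace hY : ((x ::ₘ X').map Sum.inl : Multiset (S ⊕ L)) = Sum.inl x ::ₘ Y' := hY
  rw [Multiset.map_cons, Multiset.cons_inj_right] at hY
  subst hY
  have hX' : (r t ::ₘ X').card = k := by simpa using hX
  refine ⟨⟨r t ::ₘ X', hX'⟩, Multiset.mem_cons_self _ _, ?_⟩
  have h1 := matchDist_cons_le hX hX'
  rw [gdist_inl, ← Multiset.map_cons] at e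
  exact (add_le_add_right h1 _).trans e.ge

theorem exists_feasible_le_workAt (hk : 1 ≤ k) (t : ℕ) (X : Sym S k) :
    ∃ C : ℕ → Sym S k, IsFeasible C₀ r t C ∧
      cost C t + matchDist (C t) X ≤ workAt b C₀ r t X := by
  induction t generalizing X with
  | zero =>
    refine ⟨fun _ => C₀, ⟨rfl, by simp⟩, ?_⟩
    obtain ⟨P, h1, h2, e⟩ := exists_work_zero_eq (b := b) (r := r) (C₀ := (C₀ : Multiset S))
      (Y := (X : Multiset S).map Sum.inl) (by simp)
    obtain ⟨T, rfl, h3, hT⟩ := exists_coupling h2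
    rw [workAt, e]
    refine le_trans ?_ (le_of_eq (a := ((T.map fun q => (q.1.1, q.2)).map
      fun p => dist p.1 p.2).sum) ?_)
    · simpa [cost] using matchDist_le (P := T.map fun q => (q.1.1, q.2))
        (by simpa [Function.comp_def] using h1) (by simpa [Function.comp_def] using h3)
    · simp only [Multiset.map_map, Function.comp_def]
      refine congrArg _ (Multiset.map_congr rfl fun q hq => ?_)
      rw [hT q hq, gdist_inl, dist_comm]
  | succ t ih =>
    obtain ⟨Y, hY, h1⟩ := exists_workAt_succ_eq (b := b) (C₀ := C₀) (r := r) hk t X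
    obtain ⟨C, hC, h2⟩ := ih Y
    refine ⟨fun s => if s ≤ t then C s else Y, ⟨by simpa using hC.1, fun s hs => ?_⟩, ?_⟩
    · rcases Nat.lt_or_ge s t with h | h
      · simpa [Nat.succ_le_of_lt h] using hC.2 s h
      · obtain rfl : s = t := by omega
        simpa using hY
    · have h3 : cost (fun s => if s ≤ t then C s else Y) t = cost C t :=
        Finset.sum_congr rfl fun s hs => by
          have := Finset.mem_range.1 hs
          simp [this.le, Nat.succ_le_of_lt this]
      rw [cost_succ, h3]
      have h4 := matchDist_comm_le Y X
      simp only [le_refl, if_true, Nat.not_succ_le_self, if_false]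
      linarith

theorem workFunction_eq_workAt (hb : ∀ l x y, b l x ≤ b l y + dist x y) (hk : 1 ≤ k) (t : ℕ)
    (X : Sym S k) : workFunction C₀ r t X = workAt b C₀ r t X := by
  have hlb : ∀ s ∈ {s : ℝ | ∃ C : ℕ → Sym S k, IsFeasible C₀ r t C ∧
      s = cost C t + matchDist (C t) X}, workAt b C₀ r t X ≤ s := by
    rintro _ ⟨C, hC, rfl⟩
    have h1 := workAt_le_cost hb hC
    have h2 := workAt_le_add_matchDist (C₀ := C₀) (r := r) hb t (C t) X
    linarith
  obtain ⟨C, hC, h⟩ := exists_feasible_le_workAt (b := b) (C₀ := C₀) (r := r) hk t X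
  exact le_antisymm ((csInf_le ⟨_, hlb⟩ ⟨C, hC, rfl⟩).trans h) (le_csInf ⟨_, C, hC, rfl⟩ hlb)

theorem exists_matchDist_add_workAt_le (hk : 1 ≤ k) (t : ℕ) (X : Sym S k) :
    ∃ Y : Sym S k, r t ∈ Y ∧
      matchDist X Y + workAt b C₀ r (t + 1) Y ≤ workAt b C₀ r (t + 1) X := by
  obtain ⟨Y, hY, h⟩ := exists_workAt_succ_eq (b := b) (C₀ := C₀) (r := r) hk t X
  have := workAt_succ_le (b := b) (C₀ := C₀) hY
  exact ⟨Y, hY, by linarith⟩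

theorem exists_isWFARun (hk : 1 ≤ k) (C₀ : Sym S k) (r : ℕ → S) (T : ℕ) :
    ∃ C : ℕ → Sym S k, IsWFARun C₀ r T C := by
  let b : Empty → S → ℝ := fun l => l.elim
  have hb : ∀ l x y, b l x ≤ b l y + dist x y := fun l => l.elim
  choose f hf1 hf2 using exists_matchDist_add_workAt_le (b := b) (C₀ := C₀) (r := r) hk
  refine ⟨fun t => Nat.rec C₀ (fun t X => f t X) t, ⟨rfl, fun t _ => hf1 t _⟩,
    fun t _ X hX => ?_⟩
  set D : Sym S k := Nat.rec C₀ (fun t X => f t X) t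
  rw [workFunction_eq_workAt hb hk, workFunction_eq_workAt hb hk]
  have h1 := hf2 t D
  have h2 := workAt_le_add_matchDist (C₀ := C₀) (r := r) hb (t + 1) X D
  have h3 := matchDist_comm_le X D
  change matchDist D (f t D) + workAt b C₀ r (t + 1) (f t D) ≤ _
  linarith

theorem IsWFARun.matchDist_le_sub (hb : ∀ l x y, b l x ≤ b l y + dist x y) (hk : 1 ≤ k)
    {T : ℕ} {C : ℕ → Sym S k} (hC : IsWFARun C₀ r T C) {t : ℕ} (ht : t < T) :
    matchDist (C t) (C (t + 1)) ≤
      workAt b C₀ r (t + 1) (C t) - workAt b C₀ r (t + 1) (C (t + 1)) := by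
  obtain ⟨Y, hY, h⟩ := exists_matchDist_add_workAt_le (b := b) (C₀ := C₀) (r := r) hk t (C t)
  have h1 := hC.2 t ht Y hY
  rw [workFunction_eq_workAt hb hk, workFunction_eq_workAt hb hk] at h1
  linarith

theorem opt_le_workAt (hk : 1 ≤ k) (t : ℕ) (X : Sym S k) :
    opt C₀ r t ≤ workAt b C₀ r t X := by
  obtain ⟨C, hC, h⟩ := exists_feasible_le_workAt (b := b) (C₀ := C₀) (r := r) hk t X
  have h1 := opt_le_cost hC
  have h2 := matchDist_nonneg (C t) X
  linarith

/-! ### Competitiveness -/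

theorem neg_sum_le_endWork_zero {h : S → ℝ} (hbh : ∀ l x, -h x ≤ b l x) {C₀ : Multiset S}
    {n : Multiset L} (hn : n.card = C₀.card) : -(C₀.map h).sum ≤ endWork b C₀ r 0 n := by
  obtain ⟨P, h1, h2, e⟩ := exists_work_zero_eq (b := b) (r := r) (C₀ := C₀)
    (Y := n.map Sum.inr) (by simpa using hn)
  have h3 : (P.map fun p => -h p.1).sum ≤ (P.map fun p => gdist b p.2 p.1).sum := by
    refine Multiset.sum_map_le_sum_map _ _ fun p hp => ?_
    have hp2 : p.2 ∈ n.map Sum.inr := by rw [← h2]; exact Multiset.mem_map_of_mem _ hp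
    obtain ⟨l, -, hl⟩ := Multiset.mem_map.1 hp2
    rw [← hl, gdist_inr]
    exact hbh l p.1
  rw [endWork, e, ← h1, Multiset.map_map]
  simpa [Multiset.sum_map_neg', Function.comp_def] using h3

/-- The potential increases by at least the extended cost of a request. -/
theorem potential_endWork_add_le [Fintype L] [Nontrivial L]
    (hb : ∀ l x y, b l x ≤ b l y + dist x y) (hk : 1 ≤ k) {t : ℕ} {j : L} {s : ℝ} (hs : 0 ≤ s)
    (hj : b j (r t) = -s) (hne : ∀ l ≠ j, b l (r t) = s) {X : Sym S k}
    (hfar : ∀ x ∈ X, ∃ l, b l x + dist x (r t) ≤ b l (r t)) :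
    potential k (endWork b (C₀ : Multiset S) r t) +
        (workAt b C₀ r (t + 1) X - workAt b C₀ r t X) ≤
      potential k (endWork b (C₀ : Multiset S) r (t + 1)) := by
  classical
  have hcard : (C₀ : Multiset S).card = k := C₀.2
  have hsum : ∀ n : Multiset L, (n.map fun l => b l (r t)).sum = n.card * s - 2 * s * n.count j := by
    intro n
    induction n using Multiset.induction_on with
    | empty => simp
    | cons l n ih =>
      rw [Multiset.map_cons, Multiset.sum_cons, ih, Multiset.card_cons]
      rcases eq_or_ne l j with rfl | hl
      · rw [hj, Multiset.count_cons_self]; push_cast; ring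
      · rw [hne l hl, Multiset.count_cons_of_ne hl.symm]; push_cast; ring
  obtain ⟨n, hn, hmin⟩ := exists_isMinimizer k fun n : Multiset L =>
    endWork b (C₀ : Multiset S) r t n - (n.map fun l => b l (r t)).sum
  have hn' := hn.trans hcard.symm
  have hmin' := fun (m : Multiset L) (hm : m.card = (C₀ : Multiset S).card) =>
    hmin m (hm.trans hcard)
  have h1 := work_succ_sub_le hb (by omega) hn' hmin' (X := (X : Multiset S))
    (X.2.trans hcard.symm) hfar
  have h2 : IsMinimizer k
      (fun m => endWork b (C₀ : Multiset S) r (t + 1) m + 2 * s * m.count j) n := by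
    refine ⟨hn, fun m hm => ?_⟩
    have := endWork_succ_sub_le (by omega) hn' hmin' (hm.trans hcard.symm)
    rw [hsum, hsum, hn, hm] at this
    linarith
  have hqc := quasiConvex_endWork (b := b) (C₀ := (C₀ : Multiset S)) (r := r) (t + 1)
  rw [hcard] at hqc
  have h3 := potential_add_le (w := endWork b (C₀ : Multiset S) r t) hqc (fun m hm =>
    work_le_work_succ hb t (by rw [Multiset.card_map, hm, hcard])
      (by rw [Multiset.card_map, hm]; omega)) (by linarith : 0 ≤ 2 * s) h2
  rw [workAt, workAt]
  linarith

/-- Comparison of a run `C` of the algorithm with a feasible solution `D`. The last three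
hypotheses say that the requests lie on rays among the ends, that each point of `C t` has an end
behind it as seen from the request, and that the points of `D T` lie on rays among the ends. -/
theorem cost_le_of_ends [Fintype L] [Nontrivial L] (hb : ∀ l x y, b l x ≤ b l y + dist x y)
    {h : S → ℝ} (hle : ∀ l x, b l x ≤ h x) (hge : ∀ l x, -h x ≤ b l x) (hk : 1 ≤ k) {T : ℕ}
    {C D : ℕ → Sym S k} (hC : IsWFARun C₀ r T C) (hD : IsFeasible C₀ r T D)
    (hreq : ∀ t < T, ∃ j s, 0 ≤ s ∧ b j (r t) = -s ∧ ∀ l ≠ j, b l (r t) = s)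
    (hfar : ∀ t < T, ∀ x ∈ C t, ∃ l, b l x + dist x (r t) ≤ b l (r t))
    (hend : ∀ x ∈ D T, ∃ l, b l x = -h x) :
    cost C T ≤ (k + 1) * cost D T - opt C₀ r T + (k + 1) * ((C₀ : Multiset S).map h).sum := by
  have hcard : (C₀ : Multiset S).card = k := C₀.2
  have hstep : ∀ t ≤ T, cost C t + workAt b C₀ r t (C t) +
      potential k (endWork b (C₀ : Multiset S) r 0) ≤
        potential k (endWork b (C₀ : Multiset S) r t) := by
    intro t ht
    induction t with
    | zero =>
      have := workAt_zero_le (b := b) (C₀ := C₀) (r := r)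
      rw [hC.1.1]
      simp only [cost, Finset.range_zero, Finset.sum_empty]
      linarith
    | succ t ih =>
      obtain ⟨j, s, hs, hj, hne⟩ := hreq t (by omega)
      have h1 := ih (by omega)
      have h2 := hC.matchDist_le_sub hb hk (show t < T by omega)
      have h3 := potential_endWork_add_le (C₀ := C₀) hb hk hs hj hne (hfar t (by omega))
      rw [cost_succ]
      linarith
  have h1 := hstep T le_rfl
  have h2 := opt_le_workAt (b := b) (C₀ := C₀) (r := r) hk T (C T)
  have h3 : (k + 1) * -((C₀ : Multiset S).map h).sum ≤
      potential k (endWork b (C₀ : Multiset S) r 0) :=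
    le_potential fun n hn => neg_sum_le_endWork_zero hge (hn.trans hcard.symm)
  have h4 : potential k (endWork b (C₀ : Multiset S) r T) ≤ (k + 1) * workAt b C₀ r T (D T) := by
    refine potential_le_mul hle (X := (D T : Multiset S)) (D T).2 hend fun P hP => ?_
    have hPc : P.card = k := by rw [← Multiset.card_map Prod.fst, hP]; exact (D T).2
    have := work_le_add_sum (r := r) (C₀ := (C₀ : Multiset S)) hb T
      (P.map fun p => (p.1, Sum.inr p.2)) 0 (by simp [hPc])
    rw [workAt, ← hP]
    simpa [endWork, Function.comp_def] using this
  have h5 : (k + 1) * workAt b C₀ r T (D T) ≤ (k + 1) * cost D T :=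
    mul_le_mul_of_nonneg_left (workAt_le_cost hb hD) (by positivity)
  linarith

end Algorithm

/-- Competitiveness on a metric space that consists of points on rays: `ray x` is the ray of `x`,
and `h x` is its distance from the common end of the rays, which may fail to belong to the space.
Every isometric subspace of a multiray space is of this form. -/
theorem wfaCompetitive_of_rays {S : Type u} [MetricSpace S] {ι : Type v} [DecidableEq ι]
    (ray : S → ι) (h : S → ℝ) (h0 : ∀ x, 0 ≤ h x)
    (hd : ∀ x y, dist x y = if ray x = ray y then |h x - h y| else h x + h y)
    {k : ℕ} (hk : 1 ≤ k) : WFACompetitive S k (k : ℝ) := by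
  have hlip : ∀ x y, h x ≤ h y + dist x y := by
    intro x y
    have h1 := h0 y
    rw [hd]
    split_ifs
    · have := le_abs_self (h x - h y)
      linarith
    · linarith
  refine ⟨exists_isWFARun hk, fun B hB => ?_⟩
  obtain ⟨H, hH⟩ : ∃ H, ∀ p ∈ B, h p ≤ H := by
    obtain ⟨K, hK⟩ := Metric.isBounded_iff.1 hB
    rcases B.eq_empty_or_nonempty with rfl | ⟨x, hx⟩
    · exact ⟨0, by simp⟩
    · exact ⟨h x + K, fun p hp => (hlip p x).trans (by linarith [hK hp hx])⟩
  refine ⟨(k + 1) * (k * H), fun C₀ hC₀ r T C hC => ?_⟩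
  have hsum : ((C₀ : Multiset S).map h).sum ≤ k * H := by
    have := Multiset.sum_le_card_nsmul ((C₀ : Multiset S).map h) H (by
      intro y hy
      obtain ⟨x, hx, rfl⟩ := Multiset.mem_map.1 hy
      exact hH x (hC₀ x hx))
    simpa using this
  have key : ∀ D, IsFeasible C₀ r T D →
      cost C T ≤ (k + 1) * cost D T - opt C₀ r T + (k + 1) * (k * H) := by
    intro D hD
    -- Only finitely many rays matter. Together with two directions that contain no point, they
    -- are the ends for which the potential is defined.
    let F : Set S := (⋃ t ∈ Finset.range T, insert (r t) {x | x ∈ (C t : Multiset S)}) ∪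
      {x | x ∈ (D T : Multiset S)}
    have hF : F.Finite := by
      refine Set.Finite.union (Set.Finite.biUnion (Finset.finite_toSet _) fun t _ => ?_)
        (Multiset.finite_toSet _)
      exact (Multiset.finite_toSet _).insert _
    have hrF : ∀ t < T, r t ∈ F := fun t ht => Or.inl <| by
      simp only [Set.mem_iUnion, Finset.mem_range]
      exact ⟨t, ht, Set.mem_insert _ _⟩
    have hCF : ∀ t < T, ∀ x ∈ C t, x ∈ F := fun t ht x hx => Or.inl <| by
      simp only [Set.mem_iUnion, Finset.mem_range]
      exact ⟨t, ht, Set.mem_insert_of_mem _ hx⟩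
    let R : Set ι := ray '' F
    have : Fintype R := (hF.image ray).fintype
    have : Nontrivial (R ⊕ Bool) := Sum.inr_injective.nontrivial
    let b : R ⊕ Bool → S → ℝ :=
      Sum.elim (fun i x => if ray x = i then -h x else h x) fun _ x => h x
    have hb : ∀ l x y, b l x ≤ b l y + dist x y := by
      rintro (i | e) x y
      · have h1 := h0 x
        have h2 := h0 y
        have h3 := le_abs_self (h x - h y)
        have h4 := neg_abs_le (h x - h y)
        simp only [b, Sum.elim_inl, hd]
        split_ifs <;> first | linarith | simp_all
      · exact hlip x y
    have hle : ∀ l x, b l x ≤ h x := by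
      rintro (i | e) x
      · have := h0 x
        simp only [b, Sum.elim_inl]
        split_ifs <;> linarith
      · exact le_rfl
    have hge : ∀ l x, -h x ≤ b l x := by
      rintro (i | e) x
      · have := h0 x
        simp only [b, Sum.elim_inl]
        split_ifs <;> linarith
      · have := h0 x
        simp only [b, Sum.elim_inr]
        linarith
    have hown : ∀ x (hx : x ∈ F), b (Sum.inl ⟨ray x, Set.mem_image_of_mem _ hx⟩) x = -h x :=
      fun x hx => if_pos rfl
    have hmain := cost_le_of_ends hb hle hge hk hC hD
      (fun t ht => ⟨_, h (r t), h0 _, hown _ (hrF t ht), fun l hl => by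
        rcases l with i | e
        · exact if_neg fun hi => hl (congrArg Sum.inl (Subtype.ext hi.symm))
        · rfl⟩)
      (fun t ht x hx => by
        have hxF := hCF t ht x hx
        by_cases hray : ray x = ray (r t)
        · have hd' := hd x (r t)
          rw [if_pos hray] at hd'
          rcases le_total (h x) (h (r t)) with hxr | hxr
          · refine ⟨Sum.inr true, ?_⟩
            rw [hd', abs_of_nonpos (by linarith)]
            simp only [b, Sum.elim_inr]
            linarith
          · refine ⟨Sum.inl ⟨ray x, Set.mem_image_of_mem _ hxF⟩, ?_⟩
            rw [hown x hxF, hd', abs_of_nonneg (by linarith)]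
            simp only [b, Sum.elim_inl, if_pos hray.symm]
            linarith
        · refine ⟨Sum.inl ⟨ray x, Set.mem_image_of_mem _ hxF⟩, ?_⟩
          rw [hown x hxF, hd, if_neg hray]
          simp only [b, Sum.elim_inl, if_neg (Ne.symm hray)]
          linarith)
      (fun x hx => ⟨_, hown x (Or.inr hx)⟩)
    have : (k + 1 : ℝ) * ((C₀ : Multiset S).map h).sum ≤ (k + 1) * (k * H) := by gcongr
    linarith
  have hopt : (cost C T + opt C₀ r T - (k + 1) * (k * H)) / (k + 1) ≤ opt C₀ r T := by
    refine le_csInf ⟨_, C, hC.1, rfl⟩ ?_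
    rintro _ ⟨D, hD, rfl⟩
    rw [div_le_iff₀ (by positivity)]
    linarith [key D hD]
  rw [div_le_iff₀ (by positivity)] at hopt
  linarith

end KServer

/-- For every number `k ≥ 1` of servers, the work function algorithm is `k`-competitive on every
multiray space; in particular on the line and on every weighted star. -/
theorem mainTheorem1 (k : ℕ) (hk : 1 ≤ k) :
    (∀ ι : Type u, KServer.WFACompetitive (Multiray ι) k (k : ℝ)) ∧
    KServer.WFACompetitive ℝ k (k : ℝ) ∧
    (∀ (S : Type v) [MetricSpace S] (a : S → ℝ), (∀ x, 0 ≤ a x) →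
      (∀ x y, x ≠ y → dist x y = a x + a y) →
        KServer.WFACompetitive S k (k : ℝ)) := by
  classical
  refine ⟨fun ι => ?_, ?_, fun S _ a ha hdist => ?_⟩
  · let ray : Multiray ι → Option ι := fun p => match p with
      | .center => none
      | .ray i _ _ => some i
    let h : Multiray ι → ℝ := fun p => match p with
      | .center => 0
      | .ray _ x _ => x
    refine KServer.wfaCompetitive_of_rays ray h ?_ ?_ hk
    · rintro (_ | ⟨i, x, hx⟩)
      · exact le_rfl
      · exact hx.le
    · intro p q
      change Multiray.pathDist p q = _
      rcases p with _ | ⟨i, x, hx⟩ <;> rcases q with _ | ⟨j, y, hy⟩ <;>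
        simp [Multiray.pathDist, ray, h]
  · refine KServer.wfaCompetitive_of_rays (fun x : ℝ => decide (0 ≤ x)) (fun x => |x|)
      abs_nonneg (fun x y => ?_) hk
    rw [Real.dist_eq]
    rcases le_or_gt 0 x with hx | hx <;> rcases le_or_gt 0 y with hy | hy
    · simp [hx, hy, abs_of_nonneg]
    · simp [hx, hy, hy.not_ge, abs_of_nonneg, abs_of_neg, abs_of_nonneg (by linarith : 0 ≤ x - y)]
      ring
    · simp [hx, hy, hx.not_ge, abs_of_nonneg, abs_of_neg, abs_of_neg (by linarith : x - y < 0)]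
      ring
    · simp only [hx.not_ge, hy.not_ge, abs_of_neg hx, abs_of_neg hy, if_true]
      rw [abs_sub_comm]
      congr 1
      ring
  · refine KServer.wfaCompetitive_of_rays (fun x : S => x) a ha (fun x y => ?_) hk
    rcases eq_or_ne x y with rfl | hxy
    · simp
    · rw [if_neg hxy, hdist x y hxy]
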